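/- Let $R$ be a discrete valuation ring with fraction field $K$, let $L/K$ be a finite field extension, and let $S$ be the integral closure of $R$ in $L$. For $n\ge 0$ and a commutative ring $T$, call $A,B\in \mathrm{Mat}_n(T)$ similar over $T$ if $B=UAU^{-1}$ for some $U\in \mathrm{GL}_n(T)$. Let $A,B\in\mathrm{Mat}_n(R)$, and suppose that at least one of the following holds: 1. the characteristic polynomial of $A$ is separable as a polynomial over $K$ (that is, it is coprime to its derivative in $K[x]$, equivalently it has no multiple root in an algebraic closure of $K$); 2. $n=2$. Then $A$ and $B$ are similar over $R$ if and only if they are similar over $S$. In particular, if $A$ and $B$ are similar over $S$, then they are already similar over $R$. -/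

import Mathlib

-- The matrices `X` with `A * X = X * B` form a left module `H` over the centralizer `E` of `A`, a
-- possibly noncommutative `R`-algebra. The entries of a similarity over `S` and of its inverse
-- generate a finite torsion-free, hence free, `R`-algebra of some rank `d`. Over it, right
-- multiplication by the similarity gives `E ^ d ≃ H ^ d`. Because `E` is finite over a local ring,
-- the exponent can be cancelled modulo Jacobson radicals: semisimple modules are compared by the
-- lengths of their Homs into simple modules. So `H` is generated by one `f`. Then `U` is a multiple
-- of `f`, so `det f` becomes a unit in the extension and is one already in `R`. The key steps are
-- `Module.exists_span_singleton_eq_top_of_pi_linearEquiv` and `Matrix.piCentralizerEquiv`.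

universe u

/-! ### Semisimple modules and lengths of Hom -/

section SemisimpleModules

variable {R E : Type*} [CommRing R] [Ring E] [Algebra R E]

/-- A nonzero element generates `S`, so evaluation at it is injective. The bound supplies the
finiteness needed to cancel Hom lengths in `ℕ∞`. -/
theorem Module.length_hom_le_of_isSimpleModule (S T : Type*)
    [AddCommGroup S] [Module E S] [IsSimpleModule E S]
    [AddCommGroup T] [Module R T] [Module E T] [IsScalarTower R E T] :
    Module.length R (S →ₗ[E] T) ≤ Module.length R T := by
  have := IsSimpleModule.nontrivial E S
  obtain ⟨s, hs⟩ := exists_ne (0 : S)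
  refine Module.length_le_of_injective (f := LinearMap.applyₗ' R s) fun f g hfg ↦ ?_
  refine LinearMap.ext_on (IsSimpleModule.span_singleton_eq_top E hs) ?_
  rintro _ rfl
  exact hfg

theorem LinearMap.length_hom_congr_left {X Y : Type*} (T : Type*)
    [AddCommGroup X] [Module E X] [AddCommGroup Y] [Module E Y]
    [AddCommGroup T] [Module R T] [Module E T] [IsScalarTower R E T] (e : X ≃ₗ[E] Y) :
    Module.length R (X →ₗ[E] T) = Module.length R (Y →ₗ[E] T) :=
  LinearEquiv.length_eq
    { toFun := fun f ↦ f ∘ₗ e.symm.toLinearMap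
      invFun := fun f ↦ f ∘ₗ e.toLinearMap
      map_add' := fun _ _ ↦ rfl
      map_smul' := fun _ _ ↦ rfl
      left_inv := fun f ↦ by ext; simp
      right_inv := fun f ↦ by ext; simp }

theorem Module.length_hom_quotient_jacobson (P T : Type*)
    [AddCommGroup P] [Module E P]
    [AddCommGroup T] [Module R T] [Module E T] [IsScalarTower R E T] [IsSimpleModule E T] :
    Module.length R (P ⧸ Module.jacobson E P →ₗ[E] T) = Module.length R (P →ₗ[E] T) := by
  have hker (f : P →ₗ[E] T) : Module.jacobson E P ≤ LinearMap.ker f := by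
    refine (Module.le_comap_jacobson f).trans ?_
    rw [IsSemisimpleModule.jacobson_eq_bot, Submodule.comap_bot]
  exact LinearEquiv.length_eq
    { toFun := fun f ↦ f ∘ₗ (Module.jacobson E P).mkQ
      invFun := fun f ↦ (Module.jacobson E P).liftQ f (hker f)
      map_add' := fun _ _ ↦ rfl
      map_smul' := fun _ _ ↦ rfl
      left_inv := fun f ↦ by ext; simp
      right_inv := fun f ↦ by ext; simp }

/-- Hom out of a finite power is a power of Hom, and the factor `card ι`, finite and nonzero,
cancels in `ℕ∞`. -/
theorem Module.length_hom_eq_of_pi_linearEquiv {ι P Q : Type*} [Finite ι] [Nonempty ι] (T : Type*)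
    [AddCommGroup P] [Module E P] [AddCommGroup Q] [Module E Q]
    [AddCommGroup T] [Module R T] [Module E T] [IsScalarTower R E T]
    (e : (ι → P) ≃ₗ[E] (ι → Q)) :
    Module.length R (P →ₗ[E] T) = Module.length R (Q →ₗ[E] T) := by
  classical
  have := Fintype.ofFinite ι
  have h := LinearMap.length_hom_congr_left (R := R) T e
  rw [← (LinearMap.lsum (M := T) E (fun _ : ι ↦ P) R).length_eq,
    ← (LinearMap.lsum (M := T) E (fun _ : ι ↦ Q) R).length_eq, Module.length_pi_of_fintype,
    Module.length_pi_of_fintype, Finset.sum_const, Finset.sum_const, nsmul_eq_mul,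
    nsmul_eq_mul] at h
  exact (ENat.mul_right_strictMono (by simp) (ENat.natCast_ne_top _)).injective h

/-- Semisimple modules `X`, `Y` of finite length over `R` are isomorphic as soon as
`Hom(X, T)` and `Hom(Y, T)` have the same length for every simple module `T`. -/
theorem IsSemisimpleModule.nonempty_linearEquiv_of_length_hom_eq (n : ℕ) :
    ∀ (X Y : Type u) [AddCommGroup X] [Module R X] [Module E X] [IsScalarTower R E X]
      [AddCommGroup Y] [Module R Y] [Module E Y] [IsScalarTower R E Y]
      [IsSemisimpleModule E X] [IsSemisimpleModule E Y],
      Module.length R X ≤ n →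
      (∀ (T : Type u) [AddCommGroup T] [Module R T] [Module E T] [IsScalarTower R E T]
        [IsSimpleModule E T],
        Module.length R (X →ₗ[E] T) = Module.length R (Y →ₗ[E] T)) →
      Nonempty (X ≃ₗ[E] Y) := by
  induction n with
  | zero =>
    intro X Y _ _ _ _ _ _ _ _ _ _ hX h
    have hX0 : Subsingleton X := Module.length_eq_zero_iff.mp (nonpos_iff_eq_zero.mp hX)
    have hY0 : Subsingleton Y := by
      by_contra hY
      rw [not_subsingleton_iff_nontrivial] at hY
      obtain ⟨S, hS⟩ := IsSemisimpleModule.exists_simple_submodule E Y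
      obtain ⟨p, hp⟩ := exists_isCompl S
      have h0 := h S
      rw [Module.length_eq_zero, eq_comm, Module.length_eq_zero_iff] at h0
      have := IsSimpleModule.nontrivial E S
      obtain ⟨s, hs⟩ := exists_ne (0 : S)
      apply hs
      rw [← S.projectionOnto_apply_left hp s, Subsingleton.elim (S.projectionOnto p hp) 0,
        LinearMap.zero_apply]
    exact ⟨0⟩
  | succ n ih =>
    intro X Y _ _ _ _ _ _ _ _ _ _ hX h
    by_cases hX0 : Subsingleton X
    · exact ih X Y (by rw [Module.length_eq_zero]; exact zero_le) h
    rw [not_subsingleton_iff_nontrivial] at hX0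
    obtain ⟨S, hS⟩ := IsSemisimpleModule.exists_simple_submodule E X
    obtain ⟨X', hX'⟩ := exists_isCompl S
    have := IsSimpleModule.nontrivial E S
    -- The projection of `X` onto `S` is nonzero, so `S` must also occur in `Y`; one copy is split
    -- off each side.
    have hYS : Nontrivial (Y →ₗ[E] S) := by
      rw [← Module.length_pos_iff (R := R), ← h S, Module.length_pos_iff]
      refine ⟨S.projectionOnto X' hX', 0, fun h0 ↦ ?_⟩
      obtain ⟨s, hs⟩ := exists_ne (0 : S)
      apply hs
      rw [← S.projectionOnto_apply_left hX' s, h0, LinearMap.zero_apply]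
    obtain ⟨g, hg⟩ := exists_ne (0 : Y →ₗ[E] S)
    have hgs : Function.Surjective g := LinearMap.surjective_of_ne_zero hg
    obtain ⟨Y', hY'⟩ := exists_isCompl (LinearMap.ker g)
    let eX : (S × X') ≃ₗ[E] X := Submodule.prodEquivOfIsCompl S X' hX'
    let eS : S ≃ₗ[E] Y' :=
      (g.quotKerEquivOfSurjective hgs).symm ≪≫ₗ Submodule.quotientEquivOfIsCompl _ _ hY'
    let eY : (S × LinearMap.ker g) ≃ₗ[E] Y :=
      (eS.prodCongr (LinearEquiv.refl E _)) ≪≫ₗ Submodule.prodEquivOfIsCompl Y' _ hY'.symm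
    have hlen : Module.length R X = Module.length R S + Module.length R X' := by
      rw [← Module.length_prod]
      exact (eX.restrictScalars R).length_eq.symm
    have hS1 : 1 ≤ Module.length R S := Order.one_le_iff_pos.mpr Module.length_pos
    have hX'n : Module.length R X' ≤ n := by
      have : 1 + Module.length R X' ≤ 1 + (n : ℕ∞) := by
        calc 1 + Module.length R X' ≤ Module.length R X := by rw [hlen]; gcongr
          _ ≤ 1 + (n : ℕ∞) := by rw [add_comm]; exact_mod_cast hX
      exact (ENat.add_le_add_iff_left ENat.one_ne_top).mp this
    have hSfin : Module.length R S ≠ ⊤ := by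
      refine ne_top_of_le_ne_top (ENat.natCast_ne_top (n + 1)) (le_trans ?_ hX)
      rw [hlen]
      exact le_self_add
    obtain ⟨e⟩ := ih X' (LinearMap.ker g) hX'n fun T _ _ _ _ _ ↦ by
      have hT := h T
      rw [← LinearMap.length_hom_congr_left T eX, ← LinearMap.length_hom_congr_left T eY,
        ← (LinearMap.coprodEquiv (R := E) (M := S) (M₂ := X') (M₃ := T) R).length_eq,
        ← (LinearMap.coprodEquiv (R := E) (M := S) (M₂ := LinearMap.ker g) (M₃ := T) R).length_eq,
        Module.length_prod,
        Module.length_prod] at hT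
      -- Either the `S`-terms vanish, or Schur gives `S ≃ T` and the common term has finite length
      -- and cancels.
      by_cases hST : Subsingleton (S →ₗ[E] T)
      · simpa [Module.length_eq_zero] using hT
      · rw [not_subsingleton_iff_nontrivial] at hST
        obtain ⟨f, hf⟩ := exists_ne (0 : S →ₗ[E] T)
        have eT : S ≃ₗ[E] T := LinearEquiv.ofBijective f (LinearMap.bijective_of_ne_zero hf)
        refine (ENat.add_right_injective_of_ne_top (ne_top_of_le_ne_top ?_
          (Module.length_hom_le_of_isSimpleModule S T))) hT
        rwa [← (eT.restrictScalars R).length_eq]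
    exact ⟨eX.symm ≪≫ₗ (LinearEquiv.refl E S).prodCongr e ≪≫ₗ eY⟩

end SemisimpleModules

/-! ### Finite algebras over a local ring -/

section LocalBase

variable {R E : Type*} [CommRing R] [IsLocalRing R] [Ring E] [Algebra R E]

open IsLocalRing

/-- Multiplication by `r` is `E`-linear, so by Schur it is zero or surjective; Nakayama over `R`
excludes the latter. -/
theorem IsSimpleModule.maximalIdeal_smul_eq_zero {T : Type*}
    [AddCommGroup T] [Module R T] [Module E T] [IsScalarTower R E T] [IsSimpleModule E T]
    [Module.Finite R T] {r : R} (hr : r ∈ maximalIdeal R) (t : T) : r • t = 0 := by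
  have := IsSimpleModule.nontrivial E T
  let f : T →ₗ[E] T := r • LinearMap.id
  suffices hf : f = 0 from LinearMap.congr_fun hf t
  by_contra hf
  have hsurj : Function.Surjective f := LinearMap.surjective_of_ne_zero hf
  refine Submodule.top_ne_pointwise_smul_of_mem_jacobson_annihilator (R := R) (M := T) (r := r)
    ((maximalIdeal_le_jacobson _) hr) (le_antisymm ?_ le_top)
  intro x _
  obtain ⟨y, rfl⟩ := hsurj x
  exact Submodule.smul_mem_pointwise_smul _ _ _ trivial

theorem Module.maximalIdeal_smul_mem_jacobson {P : Type*}
    [AddCommGroup P] [Module R P] [Module E P] [IsScalarTower R E P] [Module.Finite R P]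
    {r : R} (hr : r ∈ maximalIdeal R) (p : P) : r • p ∈ Module.jacobson E P := by
  refine Submodule.mem_sInf.mpr fun N (hN : IsCoatom N) ↦ ?_
  have : IsSimpleModule E (P ⧸ N) := isSimpleModule_iff_isCoatom.mpr hN
  have : Module.Finite R (P ⧸ N) :=
    Module.Finite.of_surjective (N.mkQ.restrictScalars R) N.mkQ_surjective
  rw [← Submodule.Quotient.mk_eq_zero, Submodule.Quotient.mk_smul]
  exact IsSimpleModule.maximalIdeal_smul_eq_zero (E := E) hr _

theorem IsLocalRing.isFiniteLength_of_maximalIdeal_smul_eq_zero {X : Type*}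
    [AddCommGroup X] [Module R X] [Module.Finite R X]
    (h : ∀ r ∈ maximalIdeal R, ∀ x : X, r • x = 0) : IsFiniteLength R X := by
  have htors : Module.IsTorsionBySet R X (maximalIdeal R) := fun x r ↦ h r r.2 x
  let : Module (R ⧸ maximalIdeal R) X := htors.module
  let : Field (R ⧸ maximalIdeal R) := Ideal.Quotient.field _
  have : IsScalarTower R (R ⧸ maximalIdeal R) X := htors.isScalarTower
  have : Module.Finite (R ⧸ maximalIdeal R) X := Module.Finite.of_restrictScalars_finite R _ _
  rw [← Module.length_ne_top_iff,
    Module.length_eq_of_surjective (R := R ⧸ maximalIdeal R) Ideal.Quotient.mk_surjective]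
  exact Module.length_ne_top

theorem Module.isFiniteLength_quotient_jacobson (P : Type*)
    [AddCommGroup P] [Module R P] [Module E P] [IsScalarTower R E P] [Module.Finite R P] :
    IsFiniteLength R (P ⧸ Module.jacobson E P) := by
  have : Module.Finite R (P ⧸ Module.jacobson E P) :=
    Module.Finite.of_surjective ((Module.jacobson E P).mkQ.restrictScalars R)
      (Module.jacobson E P).mkQ_surjective
  refine isFiniteLength_of_maximalIdeal_smul_eq_zero fun r hr x ↦ ?_
  obtain ⟨p, rfl⟩ := Submodule.Quotient.mk_surjective _ x
  rw [← Submodule.Quotient.mk_smul, Submodule.Quotient.mk_eq_zero]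
  exact Module.maximalIdeal_smul_mem_jacobson hr p

theorem Module.isSemisimpleModule_quotient_jacobson (R : Type*) [CommRing R] [IsLocalRing R]
    [Algebra R E] (P : Type*)
    [AddCommGroup P] [Module R P] [Module E P] [IsScalarTower R E P] [Module.Finite R P] :
    IsSemisimpleModule E (P ⧸ Module.jacobson E P) := by
  have := (isFiniteLength_iff_isNoetherian_isArtinian.mp
    (Module.isFiniteLength_quotient_jacobson (R := R) (E := E) P)).2
  have : IsArtinian E (P ⧸ Module.jacobson E P) := isArtinian_of_tower R this
  exact (IsArtinian.isSemisimpleModule_iff_jacobson E _).mpr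
    (Module.jacobson_quotient_jacobson E P)

/-- Over a module-finite algebra `E` over a local ring, a module `H` some power of which is
isomorphic to the same power of `E` is generated by one element. -/
theorem Module.exists_span_singleton_eq_top_of_pi_linearEquiv {R E H : Type u}
    [CommRing R] [IsLocalRing R] [Ring E] [Algebra R E] [Module.Finite R E]
    [AddCommGroup H] [Module R H] [Module E H] [IsScalarTower R E H] [Module.Finite R H]
    {ι : Type*} [Finite ι] [Nonempty ι] (e : (ι → E) ≃ₗ[E] (ι → H)) :
    ∃ f : H, Submodule.span E {f} = ⊤ := by
  have := Module.isSemisimpleModule_quotient_jacobson R (E := E) E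
  have := Module.isSemisimpleModule_quotient_jacobson R (E := E) H
  obtain ⟨n, hn⟩ := ENat.ne_top_iff_exists.mp (Module.length_ne_top_iff.mpr
    (Module.isFiniteLength_quotient_jacobson (R := R) (E := E) E))
  obtain ⟨φ⟩ := IsSemisimpleModule.nonempty_linearEquiv_of_length_hom_eq (R := R) (E := E) n
    (E ⧸ Module.jacobson E E) (H ⧸ Module.jacobson E H) hn.ge fun T _ _ _ _ _ ↦ by
      rw [Module.length_hom_quotient_jacobson, Module.length_hom_quotient_jacobson]
      exact Module.length_hom_eq_of_pi_linearEquiv T e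
  -- Any lift of the image of `1` generates `H` modulo its radical, hence lies in no maximal
  -- submodule.
  obtain ⟨f, hf⟩ := Submodule.Quotient.mk_surjective _ (φ (Submodule.Quotient.mk 1))
  refine ⟨f, ?_⟩
  have : Module.Finite E H := Module.Finite.of_restrictScalars_finite R E H
  refine (eq_top_or_exists_le_coatom (Submodule.span E {f})).resolve_right ?_
  rintro ⟨N, hN, hfN⟩
  refine hN.1 (eq_top_iff.mpr fun x _ ↦ ?_)
  obtain ⟨a, ha⟩ := Submodule.Quotient.mk_surjective _
    (φ.symm (Submodule.Quotient.mk x))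
  have hx : (Submodule.Quotient.mk x : H ⧸ Module.jacobson E H) = Submodule.Quotient.mk (a • f) := by
    rw [Submodule.Quotient.mk_smul, hf, ← map_smul, ← Submodule.Quotient.mk_smul, smul_eq_mul,
      mul_one, ha, LinearEquiv.apply_symm_apply]
  have hmem : x - a • f ∈ N :=
    (sInf_le hN : Module.jacobson E H ≤ N) ((Submodule.Quotient.eq _).mp hx)
  have haf : a • f ∈ N := N.smul_mem a (hfN (Submodule.mem_span_singleton_self f))
  simpa using N.add_mem hmem haf

end LocalBase

/-! ### Intertwining matrices and base change -/

section Matrices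

variable {R S n ι : Type*} [CommRing R] [CommRing S] [Algebra R S] [Fintype ι]

/-- The identification of matrices over `S` with families of matrices over `R` that is given by
a basis of `S` over `R`. -/
noncomputable def Matrix.ofBasis (b : Module.Basis ι R S) : (ι → Matrix n n R) ≃+ Matrix n n S where
  toFun X := Matrix.of fun p q ↦ b.equivFun.symm fun i ↦ X i p q
  invFun Z i := Matrix.of fun p q ↦ b.equivFun (Z p q) i
  left_inv X := by
    ext i p q
    exact congrFun (b.equivFun.apply_symm_apply fun i ↦ X i p q) i
  right_inv Z := by ext; simp
  map_add' X Y := by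
    ext p q
    exact map_add b.equivFun.symm (fun i ↦ X i p q) (fun i ↦ Y i p q)

theorem Matrix.ofBasis_apply (b : Module.Basis ι R S) (X : ι → Matrix n n R) (p q : n) :
    Matrix.ofBasis b X p q = b.equivFun.symm fun i ↦ X i p q := rfl

variable [Fintype n]

theorem Matrix.ofBasis_mul_map (b : Module.Basis ι R S) (X : ι → Matrix n n R)
    (Y : Matrix n n R) :
    Matrix.ofBasis b X * Y.map (algebraMap R S) = Matrix.ofBasis b fun i ↦ X i * Y := by
  ext p q
  simp only [Matrix.mul_apply, Matrix.ofBasis_apply, Matrix.map_apply, Module.Basis.equivFun_symm_apply,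
    Finset.sum_mul, Finset.sum_smul]
  rw [Finset.sum_comm]
  refine Finset.sum_congr rfl fun i _ ↦ Finset.sum_congr rfl fun j _ ↦ ?_
  rw [mul_comm, ← Algebra.smul_def, smul_smul, mul_comm]

theorem Matrix.map_mul_ofBasis (b : Module.Basis ι R S) (X : ι → Matrix n n R)
    (Y : Matrix n n R) :
    Y.map (algebraMap R S) * Matrix.ofBasis b X = Matrix.ofBasis b fun i ↦ Y * X i := by
  ext p q
  simp only [Matrix.mul_apply, Matrix.ofBasis_apply, Matrix.map_apply, Module.Basis.equivFun_symm_apply,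
    Finset.mul_sum, Finset.sum_smul]
  rw [Finset.sum_comm]
  refine Finset.sum_congr rfl fun i _ ↦ Finset.sum_congr rfl fun j _ ↦ ?_
  rw [← Algebra.smul_def, smul_smul]

theorem Matrix.map_mul_ofBasis_symm (b : Module.Basis ι R S) (Z : Matrix n n S)
    (Y : Matrix n n R) (i : ι) :
    (Matrix.ofBasis b).symm (Y.map (algebraMap R S) * Z) i = Y * (Matrix.ofBasis b).symm Z i := by
  obtain ⟨X, rfl⟩ := (Matrix.ofBasis b).surjective Z
  simp [Matrix.map_mul_ofBasis]

variable [DecidableEq n]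

/-- The left module over the centralizer of `A` of all matrices `X` with `A * X = X * B`. -/
def Matrix.intertwiners (A B : Matrix n n R) :
    Submodule (Subalgebra.centralizer R {A}) (Matrix n n R) where
  carrier := {X | A * X = X * B}
  add_mem' {X Y} hX hY := by
    change A * (X + Y) = (X + Y) * B
    rw [mul_add, add_mul, hX, hY]
  zero_mem' := by simp
  smul_mem' c X hX := by
    have hc : A * (c : Matrix n n R) = c * A :=
      Subalgebra.mem_centralizer_iff R |>.mp c.2 A rfl
    change A * ((c : Matrix n n R) * X) = (c : Matrix n n R) * X * B
    rw [← mul_assoc, hc, mul_assoc, hX, mul_assoc]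

theorem Matrix.mem_intertwiners {A B X : Matrix n n R} :
    X ∈ Matrix.intertwiners A B ↔ A * X = X * B := Iff.rfl

theorem Matrix.map_mul_eq_mul_map_iff (b : Module.Basis ι R S) (Z : Matrix n n S)
    (A B : Matrix n n R) :
    A.map (algebraMap R S) * Z = Z * B.map (algebraMap R S) ↔
      ∀ i, (Matrix.ofBasis b).symm Z i ∈ Matrix.intertwiners A B := by
  obtain ⟨X, rfl⟩ := (Matrix.ofBasis b).surjective Z
  simp [Matrix.map_mul_ofBasis, Matrix.ofBasis_mul_map, Matrix.mem_intertwiners, funext_iff]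

theorem Matrix.map_mul_ofBasis_eq (b : Module.Basis ι R S) (X : ι → Matrix n n R)
    {A B : Matrix n n R} (hX : ∀ i, X i ∈ Matrix.intertwiners A B) :
    A.map (algebraMap R S) * Matrix.ofBasis b X = Matrix.ofBasis b X * B.map (algebraMap R S) := by
  simpa [Matrix.map_mul_eq_mul_map_iff b] using hX

theorem Matrix.mem_centralizer_iff_mem_intertwiners {A X : Matrix n n R} :
    X ∈ Subalgebra.centralizer R {A} ↔ X ∈ Matrix.intertwiners A A := by
  simp [Subalgebra.mem_centralizer_iff, Matrix.mem_intertwiners]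

/-- A similarity between `A` and `B` over a finite free extension of rank `d` identifies
the `d`-th powers of the centralizer of `A` and of the module of intertwiners. -/
noncomputable def Matrix.piCentralizerEquiv (b : Module.Basis ι R S) {A B : Matrix n n R}
    (U : (Matrix n n S)ˣ)
    (hU : A.map (algebraMap R S) * U = U * B.map (algebraMap R S)) :
    (ι → Subalgebra.centralizer R {A}) ≃ₗ[Subalgebra.centralizer R {A}]
      (ι → Matrix.intertwiners A B) where
  toFun X i := ⟨(Matrix.ofBasis b).symm (Matrix.ofBasis b (fun j ↦ (X j : Matrix n n R)) * U) i, by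
    refine (Matrix.map_mul_eq_mul_map_iff b _ A B).mp ?_ i
    rw [← mul_assoc, Matrix.map_mul_ofBasis_eq b _
      fun j ↦ Matrix.mem_centralizer_iff_mem_intertwiners.mp (X j).2, mul_assoc, hU, mul_assoc]⟩
  invFun Y i := ⟨(Matrix.ofBasis b).symm
      (Matrix.ofBasis b (fun j ↦ (Y j : Matrix n n R)) * ↑U⁻¹) i, by
    refine Matrix.mem_centralizer_iff_mem_intertwiners.mpr
      ((Matrix.map_mul_eq_mul_map_iff b _ A A).mp ?_ i)
    have hU' : B.map (algebraMap R S) * (↑U⁻¹ : Matrix n n S) =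
        (↑U⁻¹ : Matrix n n S) * A.map (algebraMap R S) := by
      rw [Units.mul_inv_eq_iff_eq_mul, mul_assoc, hU, Units.inv_mul_cancel_left]
    rw [← mul_assoc, Matrix.map_mul_ofBasis_eq b _ fun j ↦ (Y j).2, mul_assoc, hU', mul_assoc]⟩
  left_inv X := by ext1 i; simp
  right_inv Y := by ext1 i; simp
  map_add' X Y := by
    ext1 i
    apply Subtype.ext
    have : (fun j ↦ (((X + Y) j : Subalgebra.centralizer R {A}) : Matrix n n R)) =
      (fun j ↦ (X j : Matrix n n R)) + fun j ↦ (Y j : Matrix n n R) := rfl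
    simp only [this, map_add, add_mul]
    rfl
  map_smul' c X := by
    ext1 i
    apply Subtype.ext
    have : (Matrix.ofBasis b fun j ↦ (((c • X) j : Subalgebra.centralizer R {A}) : Matrix n n R)) =
        (c : Matrix n n R).map (algebraMap R S) * Matrix.ofBasis b fun j ↦ (X j : Matrix n n R) :=
      (Matrix.map_mul_ofBasis b _ _).symm
    simp only [this, mul_assoc, Matrix.map_mul_ofBasis_symm]
    rfl

instance Matrix.finite_centralizer [IsNoetherianRing R] (A : Matrix n n R) :
    Module.Finite R (Subalgebra.centralizer R {A}) :=
  Module.Finite.of_injective (Subalgebra.centralizer R {A}).val.toLinearMap Subtype.val_injective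

instance Matrix.finite_intertwiners [IsNoetherianRing R] (A B : Matrix n n R) :
    Module.Finite R (Matrix.intertwiners A B) :=
  Module.Finite.of_injective ((Matrix.intertwiners A B).subtype.restrictScalars R)
    Subtype.val_injective

end Matrices

/-! ### Descent of similarity -/

theorem Matrix.exists_generator_intertwiners {R S : Type*} {n : ℕ} [CommRing R] [IsLocalRing R]
    [IsNoetherianRing R] [CommRing S] [Nontrivial S] [Algebra R S] [Module.Finite R S]
    [Module.Free R S] {A B : Matrix (Fin n) (Fin n) R} (U : (Matrix (Fin n) (Fin n) S)ˣ)
    (hU : A.map (algebraMap R S) * U = U * B.map (algebraMap R S)) :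
    ∃ f : Matrix (Fin n) (Fin n) R, A * f = f * B ∧
      ∀ X ∈ Matrix.intertwiners A B, ∃ c : Matrix (Fin n) (Fin n) R, c * f = X := by
  let b := Module.finBasis R S
  have : Nonempty (Fin (Module.finrank R S)) := b.index_nonempty
  obtain ⟨f, hf⟩ := Module.exists_span_singleton_eq_top_of_pi_linearEquiv (R := R)
    (E := Subalgebra.centralizer R {A}) (H := Matrix.intertwiners A B)
    (Matrix.piCentralizerEquiv b U hU)
  refine ⟨f, f.2, fun X hX ↦ ?_⟩
  have hmem : (⟨X, hX⟩ : Matrix.intertwiners A B) ∈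
      Submodule.span (Subalgebra.centralizer R {A}) {f} := by
    rw [hf]
    exact Submodule.mem_top
  obtain ⟨c, hc⟩ := Submodule.mem_span_singleton.mp hmem
  exact ⟨c, congrArg Subtype.val hc⟩

/-- Similarity of matrices over a Noetherian local ring descends along nonzero finite free
extensions. -/
theorem Matrix.isConj_of_isConj_map_of_free {R S : Type*} {n : ℕ} [CommRing R] [IsLocalRing R]
    [IsNoetherianRing R] [CommRing S] [Nontrivial S] [Algebra R S] [Module.Finite R S]
    [Module.Free R S] {A B : Matrix (Fin n) (Fin n) R}
    (h : IsConj (A.map (algebraMap R S)) (B.map (algebraMap R S))) : IsConj A B := by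
  obtain ⟨U, hU⟩ := h.symm
  obtain ⟨f, hf, hgen⟩ := Matrix.exists_generator_intertwiners U hU.eq.symm
  let b := Module.finBasis R S
  -- Every coordinate of `U` in the basis is an intertwiner over `R`, so `f` can be factored out on
  -- the right.
  choose c hc using fun i ↦ hgen _ ((Matrix.map_mul_eq_mul_map_iff b _ A B).mp hU.eq.symm i)
  have hfac : (U : Matrix (Fin n) (Fin n) S) = Matrix.ofBasis b c * f.map (algebraMap R S) := by
    rw [Matrix.ofBasis_mul_map, funext hc]
    exact ((Matrix.ofBasis b).apply_symm_apply _).symm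
  have hdet : IsUnit (algebraMap R S f.det) := by
    have := (Matrix.isUnit_iff_isUnit_det _).mp U.isUnit
    rw [hfac, Matrix.det_mul] at this
    rw [RingHom.map_det]
    exact isUnit_of_mul_isUnit_right this
  have hfu : IsUnit f :=
    (Matrix.isUnit_iff_isUnit_det _).mpr (isUnit_of_map_unit (algebraMap R S) _ hdet)
  exact IsConj.symm ⟨hfu.unit, hf.symm⟩

/-- Similarity of matrices over a discrete valuation ring descends along integral torsion-free
extensions. -/
theorem Matrix.isConj_of_isConj_map_of_isIntegral {R S : Type*} {n : ℕ} [CommRing R] [IsDomain R]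
    [IsDiscreteValuationRing R] [CommRing S] [IsDomain S] [Algebra R S] [Algebra.IsIntegral R S]
    [FaithfulSMul R S] {A B : Matrix (Fin n) (Fin n) R}
    (h : IsConj (A.map (algebraMap R S)) (B.map (algebraMap R S))) : IsConj A B := by
  obtain ⟨U, hU⟩ := h
  let V : Matrix (Fin n) (Fin n) S := ↑U⁻¹
  let s : Set S := Set.range (fun p : Fin n × Fin n ↦ (U : Matrix (Fin n) (Fin n) S) p.1 p.2) ∪
    Set.range (fun p : Fin n × Fin n ↦ V p.1 p.2)
  -- `S` itself need not be finite over `R`, but finitely many integral entries generate a finite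
  -- subalgebra. Including those of the inverse keeps `U` invertible there.
  let S' := Algebra.adjoin R s
  have hfg : (Subalgebra.toSubmodule S').FG :=
    fg_adjoin_of_finite ((Set.finite_range _).union (Set.finite_range _))
      fun x _ ↦ Algebra.IsIntegral.isIntegral x
  have : Module.Finite R S' := Module.Finite.of_fg hfg
  let W : Matrix (Fin n) (Fin n) S' := Matrix.of fun i j ↦
    ⟨(U : Matrix (Fin n) (Fin n) S) i j, Algebra.subset_adjoin (Or.inl ⟨(i, j), rfl⟩)⟩
  let W' : Matrix (Fin n) (Fin n) S' := Matrix.of fun i j ↦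
    ⟨V i j, Algebra.subset_adjoin (Or.inr ⟨(i, j), rfl⟩)⟩
  let φ : Matrix (Fin n) (Fin n) S' →+* Matrix (Fin n) (Fin n) S := S'.val.toRingHom.mapMatrix
  have hφ : Function.Injective φ := Matrix.map_injective Subtype.val_injective
  have hW : φ W = U := rfl
  have hW' : φ W' = V := rfl
  have hmap (M : Matrix (Fin n) (Fin n) R) :
      φ (M.map (algebraMap R S')) = M.map (algebraMap R S) := rfl
  let U' : (Matrix (Fin n) (Fin n) S')ˣ :=
    ⟨W, W', hφ (by simp [hW, hW', V]), hφ (by simp [hW, hW', V])⟩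
  refine Matrix.isConj_of_isConj_map_of_free (S := S') ⟨U', hφ ?_⟩
  rw [map_mul, map_mul, hmap, hmap]
  exact hU

/-- Similarity of square matrices over a commutative ring is `IsConj` in the matrix ring
(conjugacy by a unit, i.e. by an element of `GL n`). Separability of the characteristic
polynomial is meant over the fraction field `K`. -/
theorem theorem3
    {R K L S : Type*} [CommRing R] [IsDomain R] [IsDiscreteValuationRing R]
    [Field K] [Algebra R K] [IsFractionRing R K]
    [Field L] [Algebra K L] [FiniteDimensional K L]
    [Algebra R L] [IsScalarTower R K L]
    [CommRing S] [Algebra R S] [Algebra S L] [IsScalarTower R S L] [IsIntegralClosure S R L]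
    (n : ℕ) (A B : Matrix (Fin n) (Fin n) R)
    (h : (A.charpoly.map (algebraMap R K)).Separable ∨ n = 2) :
    IsConj A B ↔ IsConj (A.map (algebraMap R S)) (B.map (algebraMap R S)) := by
  refine ⟨fun hAB ↦ (algebraMap R S).mapMatrix.toMonoidHom.map_isConj hAB, fun hAB ↦ ?_⟩
  have hSL : Function.Injective (algebraMap S L) := IsIntegralClosure.algebraMap_injective S R L
  have : IsDomain S := hSL.isDomain (algebraMap S L)
  have : Algebra.IsIntegral R S := IsIntegralClosure.isIntegral_algebra R L
  have hRL : Function.Injective (algebraMap R L) := by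
    rw [IsScalarTower.algebraMap_eq R K L]
    exact (algebraMap K L).injective.comp (IsFractionRing.injective R K)
  have : FaithfulSMul R S := by
    rw [faithfulSMul_iff_algebraMap_injective]
    rw [IsScalarTower.algebraMap_eq R S L] at hRL
    exact Function.Injective.of_comp hRL
  exact Matrix.isConj_of_isConj_map_of_isIntegral hAB
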